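/- Definitions. Write $[n]=\{1,\dots,n\}$. A parking function of size $n$ is a function $g:[n]\to[n]$ such that, when cars $1,\dots,n$ arrive in this order and car $i$ takes the first free spot among $g(i),g(i)+1,\dots,n$, all cars can park. The evaluation of $f:[N]\to[n]$ is the vector $\mathrm{ev}(f)$ with $\mathrm{ev}(f)_j=|f^{-1}(j)|$ for $j\in[n]$. For $m\ge 1$, an $m$-multiparking function of size $mn$ is a function $f:[mn]\to[n]$ such that $\mathrm{ev}(f)=m\,\mathrm{ev}(g)$ for some parking function $g$ of size $n$; it is identified with the word $f(1)f(2)\cdots f(mn)$. The metasylvester congruence is the equivalence relation on words over a totally ordered alphabet generated by $$\cdots ac\cdots a\cdots\;\equiv\;\cdots ca\cdots a\cdots\quad(a<c),\qquad \cdots b\cdots ac\cdots b\cdots\;\equiv\;\cdots b\cdots ca\cdots b\cdots\quad(a<b<c),$$ where each $\cdots$ stands for an arbitrary, possibly empty, word (the same one on both sides in corresponding places). Let $p_n^{(m)}$ be the number of metasylvester classes of $m$-multiparking functions of size $mn$. Let $\mathcal{C}_n$ be the set of Catalan (Dyck) paths with $n$ up-steps and $n$ down-steps, and for $C\in\mathcal{C}_n$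 let $w(C)=(w(C)_1,\dots,w(C)_{|w(C)|})$ be the sequence of lengths, in order, of the maximal blocks of consecutive up-steps of $C$. Theorem. Let $m\ge 1$. (1) For every $n\ge 0$, $$p_n^{(m)}=\sum_{C\in\mathcal{C}_n}\prod_{i=2}^{|w(C)|}\Bigl(1+m\sum_{j=i}^{|w(C)|}w(C)_j\Bigr).$$ (2) For every $n\ge 1$, $p_n^{(m)}=\sum_{k=1}^n p_{n,k}$, where the numbers $p_{n,k}$ ($1\le k\le n$, depending on $m$) are given by $p_{n,n}=1$ and $$p_{n,k}=(1+m(n-k))\sum_{i=n-k}^{n-1}\;\sum_{j=k+1-n+i}^{i}p_{i,j}\qquad(1\le k\le n-1).$$ (3) In the ring of formal power series $\mathbb{Q}[[x]]$, $$\frac{x}{1-x}=\sum_{n=1}^\infty p_n^{(m)}\,\frac{x^n(1-x)^n}{\prod_{\ell=1}^n(1+m\ell x)}.$$ In particular, the number $p_n$ of metasylvester classes of (ordinary) parking functions of size $n$ equals $p_n^{(1)}$ for all $n\ge0$ and satisfies $$\frac{x}{1-x}=\sum_{n=1}^\infty p_n\,\frac{x^n(1-x)^n}{\prod_{\ell=1}^n(1+\ell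 x)},$$ as conjectured by Novelli and Thibon (OEIS A132624: $1, 3, 14, 87, 669, 6098,\dots$). -/

import Mathlib

open scoped PowerSeries PowerSeries.WithPiTopology

namespace Metasylvester

/-- The elementary rewritings of words that generate the metasylvester congruence:
`… ac … a … ↔ … ca … a …` for `a < c`, and
`… b … ac … b … ↔ … b … ca … b …` for `a < b < c`.
The words `u`, `v`, `w`, `x` standing for the dots are arbitrary and may be empty. -/
inductive Step {α : Type*} [LinearOrder α] : List α → List α → Prop
  | two (u v w : List α) (a c : α) (hac : a < c) :
      Step (u ++ [a, c] ++ v ++ [a] ++ w) (u ++ [c, a] ++ v ++ [a] ++ w)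
  | three (u v w x : List α) (a b c : α) (hab : a < b) (hbc : b < c) :
      Step (u ++ [b] ++ v ++ [a, c] ++ w ++ [b] ++ x) (u ++ [b] ++ v ++ [c, a] ++ w ++ [b] ++ x)

/-- The metasylvester congruence: the equivalence relation on words generated by `Step`. -/
def congruence (α : Type*) [LinearOrder α] : Setoid (List α) :=
  Relation.EqvGen.setoid Step

/-- The number of metasylvester classes that contain the word `f 0, f 1, …, f (N - 1)` of at least
one function `f` in `S`. -/
noncomputable def classCount {N n : ℕ} (S : Set (Fin N → Fin n)) : ℕ :=
  ((fun f : Fin N → Fin n => Quotient.mk (congruence (Fin n)) (List.ofFn f)) '' S).ncard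

/-- `f : [n] → [n]` is a parking function. Here `σ i` is the spot where car `i` ends up: it is the
first spot, from the preferred spot `f i` on, that is not taken by an earlier car. The function is
a parking function when every car finds such a spot. -/
def IsParking {n : ℕ} (f : Fin n → Fin n) : Prop :=
  ∃ σ : Fin n → Fin n, ∀ i,
    f i ≤ σ i ∧ (∀ j < i, σ j ≠ σ i) ∧ ∀ s, f i ≤ s → s < σ i → ∃ j < i, σ j = s

/-- The evaluation of `f : [N] → [n]`: the number of times each value is taken. -/
def ev {N n : ℕ} (f : Fin N → Fin n) (j : Fin n) : ℕ :=
  (Finset.univ.filter fun i => f i = j).card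

/-- `f : [mn] → [n]` is an `m`-multiparking function of size `mn`. -/
def IsMultiparking (m n : ℕ) (f : Fin (m * n) → Fin n) : Prop :=
  ∃ g : Fin n → Fin n, IsParking g ∧ ∀ j, ev f j = m * ev g j

/-- The number of metasylvester classes of `m`-multiparking functions of size `mn`. -/
noncomputable def multiparkingCount (m n : ℕ) : ℕ :=
  classCount {f | IsMultiparking m n f}

/-- The number of metasylvester classes of (ordinary) parking functions of size `n`. -/
noncomputable def parkingCount (n : ℕ) : ℕ :=
  classCount {f : Fin n → Fin n | IsParking f}

/-- The lengths, in order, of the maximal blocks of consecutive up-steps of a Catalan path: cut the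
path at its down-steps and record the lengths of the nonempty pieces. -/
def blocks (C : DyckWord) : List ℕ :=
  ((C.toList.splitOn DyckStep.D).map List.length).filter (0 < ·)

/-- The product `∏_{i=2}^{|w|} (1 + m ∑_{j=i}^{|w|} w_j)` for `w = (w_1, …, w_{|w|})`.
List positions are counted from `0`. -/
def weight (m : ℕ) (w : List ℕ) : ℕ :=
  ∏ i ∈ Finset.Ico 1 w.length, (1 + m * ∑ j ∈ Finset.Ico i w.length, w.getD j 0)

end Metasylvester

/-! Call a word normal if it has no subsequence `b c b` with `b < c`. Every metasylvester class
contains exactly one normal word. For existence, a non-normal word admits a step that makes it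
lexicographically larger, and classes are finite. For uniqueness, consider the number of letters `y`
after the last `z`, for `z < y`. A step can change it only if some `b` strictly between `z` and `y`
occurs on both sides of the last `z`; in a normal word such a `b` makes the count equal to the one
for `b` and `y`, so the counts are class invariants by downward induction on `z`. They determine a
normal word, read from the right.

In a normal word the copies of the least letter form one block, inserted anywhere in a normal word
on the other letters. So each evaluation has a product of factors "1 + number of larger letters" as
its number of classes (`classCount_eq_sum`). Evaluations of parking functions are the up-run lengths
of Dyck paths, zeros included, which gives (1).

For (2) and (3), cut a path after a down-step at height `h` with `r` up-steps left. The recursion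
for p_{n,k} describes the next block. On generating functions in `h` it becomes a two-term relation
between consecutive `r`, which telescopes against `kernel` (`one_sub_X_mul_sum`). -/

namespace Metasylvester

/-! ### Normal forms for the metasylvester congruence. -/

section Congruence

variable {α : Type*} [LinearOrder α]

/-- A word is normal when no two equal letters have a larger letter between them. -/
def IsNormal (w : List α) : Prop := ∀ b c, b < c → ¬ [b, c, b].Sublist w

/-- The number of letters `y` after the last `z` of a word. -/
def tailCount (w : List α) (z y : α) : ℕ := (w.rtakeWhile (· ≠ z)).count y

/-- The letter `b` occurs both before and after the last `z`. -/
def Straddles (w : List α) (z b : α) : Prop := 0 < tailCount w z b ∧ tailCount w z b < w.count b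

theorem Step.perm {w w' : List α} (h : Step w w') : w.Perm w' := by
  rcases h with ⟨u, v, w, a, c, -⟩ | ⟨u, v, w, x, a, b, c, -, -⟩
  · simp only [List.append_assoc, List.perm_append_left_iff]
    exact (List.Perm.swap c a []).append_right _
  · simp only [List.append_assoc, List.perm_append_left_iff]
    exact (List.Perm.swap c a []).append_right _

theorem rtakeWhile_append_of_mem {z : α} {t : List α} (s : List α) (hz : z ∈ t) :
    (s ++ t).rtakeWhile (· ≠ z) = t.rtakeWhile (· ≠ z) := by
  simp only [List.rtakeWhile, List.reverse_append, List.takeWhile_append]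
  rw [if_neg]
  intro h
  have := List.takeWhile_eq_self_iff.1 (List.takeWhile_prefix _ |>.eq_of_length h)
  simpa using this z (by simpa using hz)

theorem rtakeWhile_append_of_notMem {z : α} {t : List α} (s : List α) (hz : z ∉ t) :
    (s ++ t).rtakeWhile (· ≠ z) = s.rtakeWhile (· ≠ z) ++ t := by
  simp only [List.rtakeWhile, List.reverse_append, List.takeWhile_append]
  have : t.reverse.takeWhile (· ≠ z) = t.reverse :=
    List.takeWhile_eq_self_iff.2 (by intro x hx; simp at hx ⊢; rintro rfl; exact hz hx)
  rw [this]
  simp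

theorem tailCount_append_of_mem {z : α} {t : List α} (s : List α) (y : α) (hz : z ∈ t) :
    tailCount (s ++ t) z y = tailCount t z y := by
  rw [tailCount, rtakeWhile_append_of_mem s hz, tailCount]

theorem tailCount_append_of_notMem {z : α} {t : List α} (s : List α) (y : α) (hz : z ∉ t) :
    tailCount (s ++ t) z y = tailCount s z y + t.count y := by
  rw [tailCount, rtakeWhile_append_of_notMem s hz, tailCount, List.count_append]

theorem tailCount_singleton_self (z y : α) : tailCount [z] z y = 0 := by
  simp [tailCount, List.rtakeWhile]

theorem tailCount_of_notMem {z : α} {w : List α} (y : α) (hz : z ∉ w) :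
    tailCount w z y = w.count y := by
  have := tailCount_append_of_notMem [] y hz
  simpa [tailCount, List.rtakeWhile] using this

/-- Exchanging neighbours `a`, `c` can only affect the count of `c` after `a` or of `a` after `c`.
The hypothesis `h` excludes the first, `z < y` the second. -/
theorem tailCount_swap {s t : List α} {a c z y : α} (hac : a < c) (hzy : z < y)
    (h : z = a → y ≠ c) : tailCount (s ++ [a, c] ++ t) z y = tailCount (s ++ [c, a] ++ t) z y := by
  by_cases ht : z ∈ t
  · rw [tailCount_append_of_mem _ _ ht, tailCount_append_of_mem _ _ ht]
  rw [tailCount_append_of_notMem _ _ ht, tailCount_append_of_notMem _ _ ht]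
  congr 1
  rcases eq_or_ne z a with rfl | ha
  · rw [tailCount_append_of_mem _ _ (by simp), tailCount_append_of_mem _ _ (by simp)]
    have h1 : tailCount ([z] ++ [c]) z y = _ :=
      tailCount_append_of_notMem [z] y (by simpa using hac.ne)
    have h2 : tailCount ([c] ++ [z]) z y = _ := tailCount_append_of_mem [c] y (by simp)
    simp only [List.cons_append, List.nil_append] at h1 h2
    rw [h1, h2, List.count_singleton]
    simp [(h rfl).symm]
  rcases eq_or_ne z c with rfl | hc
  · rw [tailCount_append_of_mem _ _ (by simp), tailCount_append_of_mem _ _ (by simp)]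
    have h1 : tailCount ([z] ++ [a]) z y = _ :=
      tailCount_append_of_notMem [z] y (by simpa using ha)
    have h2 : tailCount ([a] ++ [z]) z y = _ := tailCount_append_of_mem [a] y (by simp)
    simp only [List.cons_append, List.nil_append] at h1 h2
    rw [h1, h2, List.count_singleton]
    simp [(hac.trans hzy).ne]
  rw [tailCount_append_of_notMem _ _ (by simp [ha, hc]),
    tailCount_append_of_notMem _ _ (by simp [ha, hc])]
  congr 1
  exact (List.Perm.swap c a []).count_eq y

/-- Two words agree when they are rearrangements of each other with the same tail counts, except
where a straddling letter makes the tail count irrelevant. -/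
def Agree (w w' : List α) : Prop :=
  w.Perm w' ∧ ∀ z y, z < y → tailCount w z y = tailCount w' z y ∨
    ∃ b, z < b ∧ b < y ∧ Straddles w z b ∧ Straddles w' z b

theorem Step.agree {w w' : List α} (h : Step w w') : Agree w w' := by
  refine ⟨h.perm, fun z y hzy => ?_⟩
  rcases h with ⟨u, v, w, a, c, hac⟩ | ⟨u, v, w, x, a, b, c, hab, hbc⟩
  · left
    by_cases hz : z = a
    · subst hz
      have hz : z ∈ v ++ [z] ++ w := by simp
      rw [List.append_assoc _ v, List.append_assoc _ (v ++ _), List.append_assoc _ v,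
        List.append_assoc _ (v ++ _), tailCount_append_of_mem _ _ hz,
        tailCount_append_of_mem _ _ hz]
    · simp only [List.append_assoc _ v, List.append_assoc _ (v ++ _)]
      exact tailCount_swap hac hzy (fun h => absurd h hz)
  · simp only [List.append_assoc _ w, List.append_assoc _ (w ++ _)]
    have hp : (u ++ [b] ++ v ++ [a, c] ++ (w ++ [b] ++ x)).Perm
        (u ++ [b] ++ v ++ [c, a] ++ (w ++ [b] ++ x)) := by
      simpa using (Step.three u v w x a b c hab hbc).perm
    by_cases hz : z = a ∧ y = c
    · obtain ⟨rfl, rfl⟩ := hz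
      by_cases ht : z ∈ w ++ [b] ++ x
      · left
        rw [tailCount_append_of_mem _ _ ht, tailCount_append_of_mem _ _ ht]
      -- The swapped `z` is now the last one, so the count of `y` does change; the two outer copies
      -- of `b` straddle this `z` in both words.
      right
      refine ⟨b, hab, hbc, ?_⟩
      have key := tailCount_swap (s := u ++ [b] ++ v) (t := w ++ [b] ++ x) (hab.trans hbc) hab
        (fun _ => hbc.ne)
      have h1 : Straddles (u ++ [b] ++ v ++ [y, z] ++ (w ++ [b] ++ x)) z b := by
        have : tailCount (u ++ [b] ++ v ++ [y, z] ++ (w ++ [b] ++ x)) z b =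
            (w ++ [b] ++ x).count b := by
          rw [tailCount_append_of_notMem _ _ ht, tailCount_append_of_mem _ _ (by simp)]
          have := tailCount_append_of_mem (z := z) [y] b (List.mem_singleton_self z)
          simp only [List.cons_append, List.nil_append] at this
          rw [this, tailCount_singleton_self, zero_add]
        rw [Straddles, this]
        constructor
        · simp
        · simp only [List.count_append, List.count_singleton_self]
          omega
      refine ⟨?_, h1⟩
      rw [Straddles, key, hp.count_eq]
      exact h1
    · left
      exact tailCount_swap (hab.trans hbc) hzy (fun h h' => hz ⟨h, h'⟩)

theorem Straddles.mem {w : List α} {z b : α} (h : Straddles w z b) : b ∈ w :=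
  List.count_pos_iff.1 (h.1.trans h.2)

theorem Agree.symm {w w' : List α} (h : Agree w w') : Agree w' w :=
  ⟨h.1.symm, fun z y hzy => (h.2 z y hzy).imp Eq.symm
    fun ⟨b, h1, h2, h3, h4⟩ => ⟨b, h1, h2, h4, h3⟩⟩

theorem exists_min_straddles {w : List α} {z b : α} (hzb : z < b) (hb : Straddles w z b) :
    ∃ d, z < d ∧ d ≤ b ∧ Straddles w z d ∧ ∀ d', z < d' → d' < d → ¬ Straddles w z d' := by
  have hfin : {d | z < d ∧ d ≤ b ∧ Straddles w z d}.Finite :=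
    (List.finite_toSet w).subset fun d hd => hd.2.2.mem
  obtain ⟨d, hd⟩ := hfin.exists_minimal ⟨b, hzb, le_rfl, hb⟩
  refine ⟨d, hd.1.1, hd.1.2.1, hd.1.2.2, fun d' h1 h2 h3 => ?_⟩
  exact absurd (hd.2 ⟨h1, h2.le.trans hd.1.2.1, h3⟩ h2.le) (not_le.2 h2)

/-- The least straddling letter of a word straddles in every agreeing word. -/
theorem Agree.straddles {w w' : List α} (h : Agree w w') {z d : α} (hzd : z < d)
    (hd : Straddles w z d) (hmin : ∀ d', z < d' → d' < d → ¬ Straddles w z d') :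
    Straddles w' z d := by
  rcases h.2 z d hzd with h1 | ⟨b, h1, h2, h3, -⟩
  · rw [Straddles, ← h1, ← h.1.count_eq]
    exact hd
  · exact absurd h3 (hmin b h1 h2)

/-- The exceptional witnesses of the two relations may differ. The least straddling letter of the
middle word straddles in both outer words and serves as a common witness; without one below `y`,
both relations give equalities. -/
theorem Agree.trans {w w' w'' : List α} (h : Agree w w') (h' : Agree w' w'') : Agree w w'' := by
  refine ⟨h.1.trans h'.1, fun z y hzy => ?_⟩
  by_cases hs : ∃ b, z < b ∧ b < y ∧ Straddles w' z b
  · obtain ⟨b, h1, h2, h3⟩ := hs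
    obtain ⟨d, hd1, hd2, hd3, hd4⟩ := exists_min_straddles h1 h3
    exact Or.inr ⟨d, hd1, hd2.trans_lt h2, h.symm.straddles hd1 hd3 hd4,
      h'.straddles hd1 hd3 hd4⟩
  · rcases h.2 z y hzy with h1 | ⟨b, h1, h2, -, h3⟩
    · rcases h'.2 z y hzy with h4 | ⟨b, h4, h5, h6, -⟩
      · exact Or.inl (h1.trans h4)
      · exact absurd ⟨b, h4, h5, h6⟩ hs
    · exact absurd ⟨b, h1, h2, h3⟩ hs

theorem agree_of_congruence {w w' : List α} (h : congruence α w w') : Agree w w' := by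
  induction h with
  | rel _ _ h => exact h.agree
  | refl _ => exact ⟨List.Perm.refl _, fun _ _ _ => Or.inl rfl⟩
  | symm _ _ _ ih => exact ih.symm
  | trans _ _ _ _ _ ih1 ih2 => exact ih1.trans ih2

theorem exists_eq_append_last {z : α} {w : List α} (h : z ∈ w) :
    ∃ s t, w = s ++ z :: t ∧ z ∉ t := by
  induction w with
  | nil => simp at h
  | cons x l ih =>
    by_cases hl : z ∈ l
    · obtain ⟨s, t, rfl, ht⟩ := ih hl
      exact ⟨x :: s, t, rfl, ht⟩
    · obtain rfl : z = x := by simpa [hl] using h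
      exact ⟨[], l, rfl, hl⟩

theorem tailCount_append_cons {z : α} {t : List α} (s : List α) (y : α) (hz : z ∉ t) :
    tailCount (s ++ z :: t) z y = t.count y := by
  have h : s ++ z :: t = (s ++ [z]) ++ t := by simp
  rw [h, tailCount_append_of_notMem _ _ hz, tailCount_append_of_mem _ _ (by simp),
    tailCount_singleton_self, zero_add]

/-- Since `b` occurs before the last `z`, a `y` between the last `z` and the last `b` would create
the forbidden pattern `b y b`. -/
theorem IsNormal.tailCount_eq {w : List α} (hw : IsNormal w) {z b y : α} (hby : b < y)
    (hb : Straddles w z b) : tailCount w z y = tailCount w b y := by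
  by_cases hz : z ∈ w
  · obtain ⟨s, t, rfl, ht⟩ := exists_eq_append_last hz
    obtain ⟨h1, h2⟩ := hb
    rw [tailCount_append_cons _ _ ht] at h1 h2 ⊢
    obtain ⟨t1, t2, rfl, ht2⟩ := exists_eq_append_last (List.count_pos_iff.1 h1)
    have hbz : b ≠ z := by rintro rfl; simp at ht
    have hbs : b ∈ s := by
      rw [List.count_append (l₁ := s), List.count_cons_of_ne hbz.symm] at h2
      exact List.count_pos_iff.1 (by omega)
    have e : s ++ z :: (t1 ++ b :: t2) = (s ++ z :: t1) ++ b :: t2 := by simp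
    rw [e, tailCount_append_cons _ _ ht2, List.count_append, List.count_cons_of_ne hby.ne]
    simp only [Nat.add_eq_right, List.count_eq_zero]
    intro hy
    refine hw b y hby ?_
    have s1 : [b].Sublist s := by simpa using hbs
    have s2 : [y].Sublist t1 := by simpa using hy
    have := s1.append (((s2.append ((List.nil_sublist t2).cons_cons b))).cons z)
    simpa using this
  · rw [Straddles, tailCount_of_notMem _ hz] at hb
    exact absurd hb.2 (lt_irrefl _)

theorem IsNormal.tailCount_eq_of_agree [WellFoundedGT α] {w w' : List α} (hw : IsNormal w)
    (hw' : IsNormal w') (h : Agree w w') (z : α) :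
    ∀ y, z < y → tailCount w z y = tailCount w' z y := by
  induction z using WellFoundedGT.induction with
  | ind z ih =>
    intro y hzy
    rcases h.2 z y hzy with h1 | ⟨b, h1, h2, h3, h4⟩
    · exact h1
    · rw [hw.tailCount_eq h2 h3, hw'.tailCount_eq h2 h4, ih b h1 y h2]

/-- At the rightmost difference, equal contents put an `x` into `s'`. If `x` is in `t`, the second
word contains `x y x`; otherwise the displayed `y` follows the last `x` in the second word only, and
the tail counts differ. -/
theorem IsNormal.not_append_lt {s s' t : List α} {x y : α} (hxy : x < y)
    (hw' : IsNormal (s' ++ [y] ++ t)) (hp : (s ++ [x] ++ t).Perm (s' ++ [y] ++ t))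
    (hD : tailCount (s ++ [x] ++ t) x y = tailCount (s' ++ [y] ++ t) x y) : False := by
  have hx : x ∈ s' := by
    have := hp.count_eq x
    simp only [List.count_append, List.count_singleton_self, List.count_singleton,
      beq_iff_eq, hxy.ne', if_false] at this
    exact List.count_pos_iff.1 (by omega)
  by_cases ht : x ∈ t
  · refine hw' x y hxy ?_
    have s1 : [x].Sublist s' := by simpa using hx
    have s2 : [x].Sublist t := by simpa using ht
    exact (s1.append (List.Sublist.refl [y])).append s2
  · rw [tailCount_append_of_notMem _ _ ht, tailCount_append_of_notMem _ _ ht,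
      tailCount_append_of_mem _ _ (by simp), tailCount_singleton_self,
      tailCount_append_of_notMem _ _ (by simpa using hxy.ne)] at hD
    simp at hD

theorem IsNormal.eq_of_tailCount_eq {w w' : List α} (hw : IsNormal w) (hw' : IsNormal w')
    (hp : w.Perm w') (hD : ∀ z y, z < y → tailCount w z y = tailCount w' z y) : w = w' := by
  suffices H : ∀ s s' t : List α, IsNormal (s ++ t) → IsNormal (s' ++ t) →
      (s ++ t).Perm (s' ++ t) →
      (∀ z y, z < y → tailCount (s ++ t) z y = tailCount (s' ++ t) z y) → s = s' by
    simpa using H w w' [] (by simpa using hw) (by simpa using hw') (by simpa using hp)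
      (by simpa using hD)
  intro s
  induction s using List.reverseRecOn with
  | nil =>
    intro s' t _ _ hp _
    have := hp.length_eq
    simp only [List.length_append, List.length_nil] at this
    exact (List.length_eq_zero_iff.1 (by omega)).symm
  | append_singleton s x ih =>
    intro s' t h1 h2 hp hD
    rcases List.eq_nil_or_concat s' with rfl | ⟨s', y, rfl⟩
    · have := hp.length_eq
      simp only [List.length_append, List.length_singleton, List.length_nil] at this
      omega
    rw [List.concat_eq_append] at *
    rcases lt_trichotomy x y with hxy | rfl | hxy
    · exact (IsNormal.not_append_lt hxy h2 hp (hD _ _ hxy)).elim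
    · rw [ih s' ([x] ++ t) (by simpa using h1) (by simpa using h2) (by simpa using hp)
        (by simpa using hD)]
    · exact (IsNormal.not_append_lt hxy h1 hp.symm (hD _ _ hxy).symm).elim

theorem IsNormal.eq_of_congruence [WellFoundedGT α] {w w' : List α} (hw : IsNormal w)
    (hw' : IsNormal w') (h : congruence α w w') : w = w' :=
  hw.eq_of_tailCount_eq hw' (agree_of_congruence h).1
    fun z => hw.tailCount_eq_of_agree hw' (agree_of_congruence h) z

/-- A discrete intermediate value argument: a word going from a letter at most `b` to one above `b`
crosses `b` between two neighbours. -/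
theorem exists_ascent {b c : α} (hbc : b < c) (v : List α) :
    ∀ a ≤ b, ∃ s a' c' t, a :: (v ++ [c]) = s ++ [a', c'] ++ t ∧ a' ≤ b ∧ b < c' := by
  induction v with
  | nil => exact fun a ha => ⟨[], a, c, [], rfl, ha, hbc⟩
  | cons d v ih =>
    intro a ha
    rcases le_or_gt d b with hd | hd
    · obtain ⟨s, a', c', t, h1, h2, h3⟩ := ih d hd
      exact ⟨a :: s, a', c', t, by simp only [List.cons_append, h1], h2, h3⟩
    · exact ⟨[], a, d, v ++ [c], rfl, ha, hd⟩

theorem exists_step_of_not_isNormal {w : List α} (hw : ¬ IsNormal w) :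
    ∃ w', Step w w' ∧ w < w' := by
  simp only [IsNormal, not_forall, not_not] at hw
  obtain ⟨b, c, hbc, h⟩ := hw
  obtain ⟨u, r, rfl, hu, h'⟩ := List.cons_sublist_iff.1 h
  obtain ⟨v, r, rfl, hv, h''⟩ := List.cons_sublist_iff.1 h'
  obtain ⟨u1, u2, rfl⟩ := List.append_of_mem hu
  obtain ⟨v1, v2, rfl⟩ := List.append_of_mem hv
  obtain ⟨r1, r2, rfl⟩ := List.append_of_mem (List.singleton_sublist.1 h'')
  obtain ⟨s, a', c', t, h1, h2, h3⟩ := exists_ascent hbc (u2 ++ v1) b le_rfl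
  have e : u1 ++ b :: u2 ++ (v1 ++ c :: v2 ++ (r1 ++ b :: r2)) =
      u1 ++ (s ++ [a', c'] ++ t) ++ (v2 ++ (r1 ++ b :: r2)) := by
    rw [← h1]; simp
  have hlt : ∀ p q : List α, p ++ ([a', c'] ++ q) < p ++ ([c', a'] ++ q) := by
    intro p q
    apply List.append_left_lt
    exact List.Lex.rel (h2.trans_lt h3)
  rw [e]
  -- An ascent starting at `b` itself falls under the first rule, one starting below `b` under the
  -- second. In the second case the initial `b` lies strictly before the ascent.
  rcases h2.eq_or_lt with rfl | h2
  · refine ⟨(u1 ++ s) ++ [c', a'] ++ (t ++ v2 ++ r1) ++ [a'] ++ r2, ?_, ?_⟩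
    · have := Step.two (u1 ++ s) (t ++ v2 ++ r1) r2 a' c' h3
      simpa using this
    · have := hlt (u1 ++ s) ((t ++ v2 ++ r1) ++ [a'] ++ r2)
      simpa using this
  · cases s with
    | nil =>
      simp only [List.nil_append, List.cons_append, List.cons.injEq] at h1
      exact absurd h1.1 h2.ne'
    | cons d s =>
      simp only [List.cons_append, List.cons.injEq] at h1
      obtain ⟨rfl, -⟩ := h1
      refine ⟨u1 ++ [b] ++ s ++ [c', a'] ++ (t ++ v2 ++ r1) ++ [b] ++ r2, ?_, ?_⟩
      · have := Step.three u1 s (t ++ v2 ++ r1) r2 a' b c' h2 h3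
        simpa using this
      · have := hlt (u1 ++ [b] ++ s) ((t ++ v2 ++ r1) ++ [b] ++ r2)
        simpa using this

theorem exists_isNormal (w : List α) : ∃ w', congruence α w w' ∧ IsNormal w' := by
  have hfin : {w' | congruence α w w'}.Finite :=
    (List.finite_toSet w.permutations).subset fun w' h =>
      List.mem_permutations.2 (agree_of_congruence h).1.symm
  obtain ⟨w', h1, h2⟩ := hfin.exists_maximal ⟨w, (congruence α).refl w⟩
  refine ⟨w', h1, by_contra fun hn => ?_⟩
  obtain ⟨w'', hs, hlt⟩ := exists_step_of_not_isNormal hn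
  exact absurd (h2 ((congruence α).trans h1 (Relation.EqvGen.rel _ _ hs)) hlt.le) (not_le.2 hlt)

end Congruence

/-! ### Counting normal words with a given evaluation. -/

section NormalWords

variable {α : Type*} [LinearOrder α]

/-- The number of normal words whose letters occur, in increasing order, with the given
multiplicities. -/
def insertionCount : List ℕ → ℕ
  | [] => 1
  | x :: l => (if x = 0 then 1 else l.sum + 1) * insertionCount l

/-- The normal words in the letters of an increasing list, where `x` occurs `e x` times. They are
built by inserting the occurrences of the least letter as one block. -/
def normalWords (e : α → ℕ) : List α → Finset (List α)
  | [] => {[]}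
  | a :: L =>
    if e a = 0 then normalWords e L else
      (normalWords e L ×ˢ Finset.range ((L.map e).sum + 1)).image
        fun p => p.1.take p.2 ++ (List.replicate (e a) a ++ p.1.drop p.2)

theorem IsNormal.sublist {v w : List α} (hw : IsNormal w) (h : v.Sublist w) : IsNormal v :=
  fun b c hbc h' => hw b c hbc (h'.trans h)

theorem length_of_mem_normalWords {e : α → ℕ} {L : List α} :
    ∀ {w}, w ∈ normalWords e L → w.length = (L.map e).sum := by
  induction L with
  | nil => intro w hw; simpa [normalWords] using hw
  | cons a L ih =>
    intro w hw
    rw [normalWords] at hw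
    split_ifs at hw with h
    · simp [ih hw, h]
    · obtain ⟨⟨v, i⟩, hv, rfl⟩ := Finset.mem_image.1 hw
      simp only [Finset.mem_product, Finset.mem_range] at hv
      have := ih hv.1
      simp only [List.length_append, List.length_take, List.length_replicate, List.length_drop,
        List.map_cons, List.sum_cons]
      omega

theorem filter_insert_block {a : α} {v : List α} (hv : a ∉ v) (i k : ℕ) :
    (v.take i ++ (List.replicate k a ++ v.drop i)).filter (· ≠ a) = v := by
  have h : ∀ s : List α, a ∉ s → s.filter (· ≠ a) = s := fun s hs =>
    List.filter_eq_self.2 fun x hx => by simpa using fun h : x = a => hs (h ▸ hx)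
  rw [List.filter_append, List.filter_append, h _ (fun h => hv (List.mem_of_mem_take h)),
    h _ (fun h => hv (List.mem_of_mem_drop h))]
  simp

theorem takeWhile_insert_block {a : α} {v : List α} (hv : a ∉ v) (i : ℕ) {k : ℕ} (hk : k ≠ 0) :
    (v.take i ++ (List.replicate k a ++ v.drop i)).takeWhile (· ≠ a) = v.take i := by
  obtain ⟨k, rfl⟩ := Nat.exists_eq_succ_of_ne_zero hk
  rw [List.takeWhile_append_of_pos]
  · simp [List.replicate_succ]
  · intro x hx
    simpa using fun h : x = a => hv (h ▸ List.mem_of_mem_take hx)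

/-- A forbidden pattern on `a` would need a larger letter inside the block; one on a letter above
`a` survives deleting the block and lies in `v`. -/
theorem IsNormal.insert_block {a : α} {v : List α} (hv : IsNormal v) (ha : ∀ x ∈ v, a < x)
    (i k : ℕ) : IsNormal (v.take i ++ (List.replicate k a ++ v.drop i)) := by
  have hav : a ∉ v := fun h => lt_irrefl _ (ha a h)
  intro b c hbc h
  have hmem : ∀ x ∈ v.take i ++ (List.replicate k a ++ v.drop i), a ≤ x := by
    intro x hx
    simp only [List.mem_append, List.mem_replicate] at hx
    rcases hx with hx | ⟨-, rfl⟩ | hx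
    · exact (ha x (List.mem_of_mem_take hx)).le
    · exact le_rfl
    · exact (ha x (List.mem_of_mem_drop hx)).le
  have hab : a ≤ b := hmem b (h.subset (by simp))
  have hc : c ≠ a := (hab.trans_lt hbc).ne'
  rcases hab.eq_or_lt with rfl | hab
  · obtain ⟨l1, l2, e1, h1, h2⟩ := List.sublist_append_iff.1 h
    have hl1 : l1 = [] := by
      cases l1 with
      | nil => rfl
      | cons x l1 =>
        simp only [List.cons_append, List.cons.injEq] at e1
        exact absurd (List.mem_of_mem_take (h1.subset (by simp [e1.1]))) hav
    subst hl1
    obtain ⟨l3, l4, e2, h3, h4⟩ := List.sublist_append_iff.1 h2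
    rw [List.nil_append] at e1
    rw [← e1] at e2
    have hl4 : l4 = [] := by
      rcases List.eq_nil_or_concat l4 with h | ⟨l, x, rfl⟩
      · exact h
      · have : ([a, c] ++ [a] : List α) = (l3 ++ l) ++ [x] := by simpa using e2
        have := (List.append_inj' this rfl).2
        simp only [List.cons.injEq, and_true] at this
        exact absurd (List.mem_of_mem_drop (h4.subset (by simp [this]))) hav
    subst hl4
    rw [List.append_nil] at e2
    exact hc (List.eq_of_mem_replicate (h3.subset (by simp [← e2])))
  · have := h.filter (· ≠ a)
    rw [filter_insert_block hav] at this
    exact hv b c hbc (by simpa [hab.ne', hc] using this)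

theorem IsNormal.exists_eq_insert_block {a : α} {w : List α} (hw : IsNormal w)
    (ha : ∀ x ∈ w, a ≤ x) (haw : a ∈ w) :
    ∃ s t, w = s ++ (List.replicate (w.count a) a ++ t) ∧ a ∉ s ∧ a ∉ t := by
  obtain ⟨s, r, rfl, hs⟩ := List.eq_append_cons_of_mem haw
  -- `m` runs from the first `a` up to just before the last one; normality and minimality of `a`
  -- force all its letters to be `a`.
  obtain ⟨m, t, hm, ht⟩ := exists_eq_append_last (List.mem_cons_self (a := a) (l := r))
  have hall : ∀ x ∈ m, x = a := by
    intro x hx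
    by_contra hxa
    have hax : a < x := lt_of_le_of_ne
      (ha x (by rw [hm]; simp [hx])) (Ne.symm hxa)
    cases m with
    | nil => simp at hx
    | cons y m =>
      simp only [List.cons_append, List.cons.injEq] at hm
      obtain ⟨rfl, hm⟩ := hm
      have hx : x ∈ m := by simpa [hxa] using hx
      refine hw a x hax (List.Sublist.trans ?_ (List.sublist_append_right _ _))
      rw [hm]
      exact ((List.singleton_sublist.2 hx).append ((List.nil_sublist t).cons_cons a)).cons_cons a
  have hm' : m = List.replicate m.length a := List.eq_replicate_iff.2 ⟨rfl, hall⟩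
  refine ⟨s, t, ?_, hs, ht⟩
  have hc : (s ++ a :: r).count a = m.length + 1 := by
    rw [hm, List.count_append, List.count_append, List.count_cons_self,
      List.count_eq_zero.2 hs, List.count_eq_zero.2 ht, hm']
    simp
  rw [hc, hm, List.replicate_succ', ← hm']
  simp

theorem mem_normalWords {e : α → ℕ} {L : List α} (hL : L.Pairwise (· < ·)) :
    ∀ {w}, w ∈ normalWords e L ↔
      IsNormal w ∧ (∀ x ∈ w, x ∈ L) ∧ ∀ x ∈ L, w.count x = e x := by
  induction L with
  | nil =>
    intro w
    simp only [normalWords, Finset.mem_singleton, List.not_mem_nil, imp_false, false_imp_iff,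
      implies_true, and_true, ← List.eq_nil_iff_forall_not_mem, iff_and_self]
    rintro rfl b c _ h
    simp at h
  | cons a L ih =>
    intro w
    rw [List.pairwise_cons] at hL
    have haL : a ∉ L := fun h => lt_irrefl _ (hL.1 a h)
    have ih := @ih hL.2
    rw [normalWords]
    split_ifs with h0
    · rw [ih]
      constructor
      · rintro ⟨h1, h2, h3⟩
        refine ⟨h1, fun x hx => List.mem_cons_of_mem _ (h2 x hx), fun x hx => ?_⟩
        rcases List.mem_cons.1 hx with rfl | hx
        · rw [h0, List.count_eq_zero]
          exact fun h => haL (h2 _ h)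
        · exact h3 x hx
      · rintro ⟨h1, h2, h3⟩
        refine ⟨h1, fun x hx => ?_, fun x hx => h3 x (List.mem_cons_of_mem _ hx)⟩
        rcases List.mem_cons.1 (h2 x hx) with rfl | h
        · have := h3 x List.mem_cons_self
          rw [h0, List.count_eq_zero] at this
          exact absurd hx this
        · exact h
    · rw [Finset.mem_image]
      constructor
      · rintro ⟨⟨v, i⟩, hv, rfl⟩
        simp only [Finset.mem_product, Finset.mem_range] at hv ⊢
        obtain ⟨h1, h2, h3⟩ := ih.1 hv.1
        have hav : a ∉ v := fun h => haL (h2 a h)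
        have hcount : ∀ x, (v.take i ++ (List.replicate (e a) a ++ v.drop i)).count x =
            v.count x + (List.replicate (e a) a).count x := by
          intro x
          conv_rhs => rw [← List.take_append_drop i v]
          simp only [List.count_append]
          omega
        refine ⟨h1.insert_block (fun x hx => hL.1 x (h2 x hx)) _ _, ?_, ?_⟩
        · intro x hx
          simp only [List.mem_append, List.mem_replicate] at hx
          rcases hx with hx | ⟨-, rfl⟩ | hx
          · exact List.mem_cons_of_mem _ (h2 x (List.mem_of_mem_take hx))
          · exact List.mem_cons_self
          · exact List.mem_cons_of_mem _ (h2 x (List.mem_of_mem_drop hx))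
        · intro x hx
          rw [hcount]
          rcases List.mem_cons.1 hx with rfl | hx
          · rw [List.count_eq_zero.2 hav, List.count_replicate_self, zero_add]
          · rw [h3 x hx, List.count_eq_zero.2, add_zero]
            intro h
            exact haL (List.eq_of_mem_replicate h ▸ hx)
      · rintro ⟨h1, h2, h3⟩
        have ha := h3 a List.mem_cons_self
        obtain ⟨s, t, hst, hs, ht⟩ := h1.exists_eq_insert_block (a := a)
          (fun x hx => by
            rcases List.mem_cons.1 (h2 x hx) with rfl | h
            exacts [le_rfl, (hL.1 x h).le])
          (List.count_pos_iff.1 (by omega))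
        rw [ha] at hst
        subst hst
        have hmem : s ++ t ∈ normalWords e L := by
          refine ih.2 ⟨h1.sublist ?_, fun x hx => ?_, fun x hx => ?_⟩
          · exact (List.Sublist.refl s).append (List.sublist_append_right _ _)
          · have hxa : x ≠ a := by
              rintro rfl
              rcases List.mem_append.1 hx with h | h
              exacts [hs h, ht h]
            have := h2 x (by
              rcases List.mem_append.1 hx with h | h <;> simp [h])
            simpa [hxa] using this
          · have hxa : a ≠ x := fun h => haL (h ▸ hx)
            rw [← h3 x (List.mem_cons_of_mem _ hx)]
            simp [List.count_append, List.count_replicate, hxa]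
        refine ⟨(s ++ t, s.length), ?_, by simp⟩
        have := length_of_mem_normalWords hmem
        rw [List.length_append] at this
        simp only [Finset.mem_product, Finset.mem_range, hmem, true_and]
        omega

theorem card_normalWords (e : α → ℕ) {L : List α} (hL : L.Pairwise (· < ·)) :
    (normalWords e L).card = insertionCount (L.map e) := by
  induction L with
  | nil => rfl
  | cons a L ih =>
    rw [List.pairwise_cons] at hL
    have haL : a ∉ L := fun h => lt_irrefl _ (hL.1 a h)
    rw [normalWords, List.map_cons, insertionCount, ← ih hL.2]
    split_ifs with h0
    · simp
    · rw [Finset.card_image_of_injOn, Finset.card_product, Finset.card_range, mul_comm]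
      rintro ⟨v, i⟩ hv ⟨v', i'⟩ hv' h
      simp only [Finset.coe_product, Set.mem_prod, Finset.mem_coe, Finset.mem_range] at hv hv' h
      have hav : a ∉ v := fun h => haL (((mem_normalWords hL.2).1 hv.1).2.1 a h)
      have hav' : a ∉ v' := fun h => haL (((mem_normalWords hL.2).1 hv'.1).2.1 a h)
      -- Deleting `a` recovers the smaller word; the length of the prefix before the first `a`
      -- recovers the insertion position.
      have h1 := congrArg (List.filter (· ≠ a)) h
      rw [filter_insert_block hav, filter_insert_block hav'] at h1
      have h2 := congrArg (fun l => (List.takeWhile (· ≠ a) l).length) h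
      simp only [takeWhile_insert_block hav _ h0, takeWhile_insert_block hav' _ h0,
        List.length_take, length_of_mem_normalWords hv.1, length_of_mem_normalWords hv'.1] at h2
      rw [Prod.mk.injEq]
      exact ⟨h1, by omega⟩

end NormalWords

theorem count_ofFn {N n : ℕ} (f : Fin N → Fin n) (j : Fin n) : (List.ofFn f).count j = ev f j := by
  rw [ev, List.ofFn_eq_map, List.count_eq_countP, List.countP_map, Finset.card_def,
    Finset.filter_val, ← Multiset.countP_eq_card_filter]
  change _ = Multiset.countP _ (Multiset.ofList (List.finRange N))
  rw [Multiset.coe_countP]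
  congr 1

/-- Classes of words are counted by the normal words with the same contents. -/
theorem classCount_eq_sum {N n : ℕ} (E : Finset (Fin n → ℕ)) (hE : ∀ e ∈ E, ∑ j, e j = N) :
    classCount {f : Fin N → Fin n | ev f ∈ E} =
      ∑ e ∈ E, insertionCount (List.ofFn e) := by
  have hL : (List.finRange n).Pairwise (· < ·) := List.pairwise_lt_finRange n
  have hmem : ∀ {e : Fin n → ℕ} {w}, w ∈ normalWords e (List.finRange n) ↔
      IsNormal w ∧ ∀ x, w.count x = e x := by
    intro e w
    rw [mem_normalWords hL]
    simp
  have himage : (fun f : Fin N → Fin n => Quotient.mk (congruence (Fin n)) (List.ofFn f)) ''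
      {f | ev f ∈ E} = Quotient.mk (congruence (Fin n)) ''
        (E.biUnion fun e => normalWords e (List.finRange n) : Finset (List (Fin n))) := by
    ext q
    simp only [Set.mem_image, Set.mem_ofPred_eq, Finset.coe_biUnion, Set.mem_iUnion, Finset.mem_coe,
      exists_prop]
    constructor
    · rintro ⟨f, hf, rfl⟩
      obtain ⟨w, h1, h2⟩ := exists_isNormal (List.ofFn f)
      refine ⟨w, ⟨ev f, hf, hmem.2 ⟨h2, fun x => ?_⟩⟩, (Quotient.sound h1).symm⟩
      rw [← (agree_of_congruence h1).1.count_eq, count_ofFn]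
    · rintro ⟨w, ⟨e, he, hw⟩, rfl⟩
      have hlen : w.length = N := by
        rw [length_of_mem_normalWords hw, ← List.ofFn_eq_map, List.sum_ofFn, hE e he]
      subst hlen
      refine ⟨w.get, ?_, by rw [List.ofFn_get]⟩
      have : ev w.get = e := by
        ext j
        rw [← count_ofFn, List.ofFn_get, (hmem.1 hw).2]
      rwa [this]
  rw [classCount, himage, Set.InjOn.ncard_image, Set.ncard_coe_finset, Finset.card_biUnion]
  · refine Finset.sum_congr rfl fun e _ => ?_
    rw [card_normalWords e hL, ← List.ofFn_eq_map]
  · intro e _ e' _ hne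
    refine Finset.disjoint_left.2 fun w hw hw' => hne ?_
    ext x
    rw [← (hmem.1 hw).2, (hmem.1 hw').2]
  · intro w hw w' hw' h
    simp only [Finset.coe_biUnion, Set.mem_iUnion, Finset.mem_coe, exists_prop] at hw hw'
    obtain ⟨e, -, hw⟩ := hw
    obtain ⟨e', -, hw'⟩ := hw'
    exact (hmem.1 hw).1.eq_of_congruence (hmem.1 hw').1 (Quotient.exact h)

/-! ### Up-run sequences of lattice paths. -/

section Contents

/-- The sequences of lengths of up-runs, each followed by one down-step, of the paths that start at
height `h`, never go below height `0` and end there. -/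
def IsContent : ℕ → List ℕ → Prop
  | h, [] => h = 0
  | h, e :: l => 1 ≤ h + e ∧ IsContent (h + e - 1) l

/-- The height after `t` entries equals the remaining down-steps minus the remaining up-steps, so
nonnegativity is a bound on suffix sums. -/
theorem isContent_iff {h : ℕ} {l : List ℕ} :
    IsContent h l ↔ h + l.sum = l.length ∧ ∀ t ≤ l.length, (l.drop t).sum + t ≤ l.length := by
  induction l generalizing h with
  | nil => simp [IsContent]
  | cons e l ih =>
    rw [IsContent, ih]
    simp only [List.sum_cons, List.length_cons]
    constructor
    · rintro ⟨h1, h2, h3⟩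
      refine ⟨by omega, fun t ht => ?_⟩
      cases t with
      | zero => simp only [List.drop_zero, List.sum_cons]; omega
      | succ t =>
        have := h3 t (by omega)
        rw [List.drop_succ_cons]
        omega
    · rintro ⟨h1, h2⟩
      have := h2 1 (by omega)
      simp only [List.drop_succ_cons, List.drop_zero] at this
      refine ⟨by omega, by omega, fun t ht => ?_⟩
      have := h2 (t + 1) (by omega)
      rw [List.drop_succ_cons] at this
      omega

/-- The contents of length `N` at height `h`. -/
def contents : ℕ → ℕ → Finset (List ℕ)
  | 0, h => if h = 0 then {[]} else ∅
  | N + 1, h => ((Finset.range (N + 2 - h)).filter (1 ≤ h + ·)).biUnion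
      fun e => (contents N (h + e - 1)).image (e :: ·)

theorem mem_contents {N h : ℕ} {l : List ℕ} : l ∈ contents N h ↔ l.length = N ∧ IsContent h l := by
  induction N generalizing h l with
  | zero =>
    rw [contents, List.length_eq_zero_iff]
    split_ifs with h0
    · subst h0
      rw [Finset.mem_singleton]
      exact ⟨by rintro rfl; exact ⟨rfl, rfl⟩, fun h => h.1⟩
    · simp only [Finset.notMem_empty, false_iff, not_and]
      rintro rfl
      exact h0
  | succ N ih =>
    simp only [contents, Finset.mem_biUnion, Finset.mem_filter, Finset.mem_range, Finset.mem_image,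
      ih]
    constructor
    · rintro ⟨e, he, l, ⟨h1, h2⟩, rfl⟩
      exact ⟨by simp [h1], he.2, h2⟩
    · rintro ⟨h1, h2⟩
      cases l with
      | nil => simp at h1
      | cons e l =>
        obtain ⟨h2, h3⟩ := h2
        rw [List.length_cons, Nat.add_right_cancel_iff] at h1
        have := (isContent_iff.1 h3).1
        exact ⟨e, ⟨by omega, h2⟩, l, ⟨h1, h3⟩, rfl⟩

end Contents

/-! ### Evaluations of parking and multiparking functions. -/

section Parking

variable {n : ℕ}

theorem sum_ev {N : ℕ} (f : Fin N → Fin n) : ∑ j, ev f j = N := by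
  simp only [ev]
  rw [← Finset.card_eq_sum_card_fiberwise (fun _ _ => Finset.mem_coe.2 (Finset.mem_univ _)),
    Finset.card_univ, Fintype.card_fin]

theorem card_filter_le_val (t : ℕ) :
    (Finset.univ.filter fun s : Fin n => t ≤ (s : ℕ)).card = n - t := by
  have h1 := Finset.card_filter_add_card_filter_not (s := (Finset.univ : Finset (Fin n)))
    (fun s => (s : ℕ) < t)
  simp only [Fin.card_filter_val_lt, not_lt, Finset.card_univ, Fintype.card_fin] at h1
  omega

/-- At most `n - t` cars prefer one of the last `n - t` spots. -/
def IsSparse (f : Fin n → Fin n) : Prop :=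
  ∀ t, (Finset.univ.filter fun i => t ≤ (f i : ℕ)).card ≤ n - t

theorem IsParking.isSparse {f : Fin n → Fin n} (hf : IsParking f) : IsSparse f := by
  obtain ⟨σ, hσ⟩ := hf
  have hinj : Function.Injective σ := by
    intro i j hij
    rcases lt_trichotomy i j with h | h | h
    · exact absurd hij ((hσ j).2.1 i h)
    · exact h
    · exact absurd hij.symm ((hσ i).2.1 j h)
  intro t
  rw [← card_filter_le_val t]
  refine Finset.card_le_card_of_injOn σ (fun i hi => ?_) hinj.injOn
  simp only [Finset.coe_filter, Finset.mem_univ, true_and, Set.mem_ofPred_eq] at hi ⊢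
  exact hi.trans (hσ i).1

/-- Otherwise take the least `t` such that earlier cars fill all spots from `t` on. Each of these
cars prefers a spot at least `t`, or it would have passed an occupied spot `t - 1`. With car `k`
itself, more than `n - t` cars prefer such spots. -/
theorem IsSparse.exists_free_spot {f : Fin n → Fin n} (hf : IsSparse f) {σ : Fin n → Fin n}
    (k : Fin n) (hσ : ∀ i < k, f i ≤ σ i ∧ ∀ s, f i ≤ s → s < σ i → ∃ j < i, σ j = s) :
    ∃ s, f k ≤ s ∧ ∀ j < k, σ j ≠ s := by
  by_contra! hcon
  have hex : ∃ t : ℕ, ∀ s : Fin n, t ≤ s → ∃ j < k, σ j = s := ⟨f k, fun s hs => hcon s hs⟩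
  classical
  set t := Nat.find hex with ht
  have hfull := Nat.find_spec hex
  have htk : t ≤ f k := Nat.find_min' hex fun s hs => hcon s hs
  have hpref : ∀ j < k, t ≤ (σ j : ℕ) → t ≤ (f j : ℕ) := by
    intro j hj hjt
    by_contra! hlt
    refine Nat.find_min hex (m := t - 1) (by omega) fun s hs => ?_
    by_cases hs' : t ≤ (s : ℕ)
    · exact hfull s hs'
    · obtain ⟨i, hi, his⟩ := (hσ j hj).2 s (Fin.le_def.2 (by omega)) (Fin.lt_def.2 (by omega))
      exact ⟨i, hi.trans hj, his⟩
  have hsub : (Finset.univ.filter fun s : Fin n => t ≤ (s : ℕ)) ⊆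
      (Finset.univ.filter fun j => j < k ∧ t ≤ (f j : ℕ)).image σ := by
    intro s hs
    obtain ⟨j, hj, rfl⟩ := hfull s (Finset.mem_filter.1 hs).2
    exact Finset.mem_image.2
      ⟨j, by simpa using ⟨hj, hpref j hj (Finset.mem_filter.1 hs).2⟩, rfl⟩
  have h1 := (Finset.card_le_card hsub).trans Finset.card_image_le
  have h2 : (Finset.univ.filter fun j => j < k ∧ t ≤ (f j : ℕ)) ⊂
      Finset.univ.filter fun j => t ≤ (f j : ℕ) := by
    refine Finset.ssubset_iff_of_subset (fun j hj => ?_) |>.2 ⟨k, ?_, ?_⟩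
    · exact Finset.mem_filter.2 ⟨Finset.mem_univ _, (Finset.mem_filter.1 hj).2.2⟩
    · simpa using htk
    · simp
  have h3 := Finset.card_lt_card h2
  rw [card_filter_le_val] at h1
  have := hf t
  omega

theorem IsSparse.isParking {f : Fin n → Fin n} (hf : IsSparse f) : IsParking f := by
  suffices H : ∀ k ≤ n, ∃ σ : Fin n → Fin n, ∀ i : Fin n, (i : ℕ) < k →
      f i ≤ σ i ∧ (∀ j < i, σ j ≠ σ i) ∧ ∀ s, f i ≤ s → s < σ i → ∃ j < i, σ j = s by
    obtain ⟨σ, hσ⟩ := H n le_rfl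
    exact ⟨σ, fun i => hσ i i.2⟩
  intro k
  induction k with
  | zero => exact fun _ => ⟨id, fun i hi => absurd hi (Nat.not_lt_zero _)⟩
  | succ k ih =>
    intro hk
    obtain ⟨σ, hσ⟩ := ih (Nat.le_of_succ_le hk)
    let c : Fin n := ⟨k, hk⟩
    have hex := hf.exists_free_spot (σ := σ) c
      fun i hi => ⟨(hσ i hi).1, (hσ i hi).2.2⟩
    -- Car `c` takes its first free spot; the values of `σ` at later cars are irrelevant at this
    -- stage.
    obtain ⟨s, hs⟩ := (Set.toFinite {s | f c ≤ s ∧ ∀ j < c, σ j ≠ s}).exists_minimal hex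
    have hne : ∀ {i j : Fin n}, j < i → (i : ℕ) ≤ k → Function.update σ c s j = σ j :=
      fun hji hi => Function.update_of_ne (Fin.ne_of_lt (Fin.lt_def.2 (by
        have := Fin.lt_def.1 hji
        change _ < k
        omega))) _ _
    refine ⟨Function.update σ c s, fun i hi => ?_⟩
    rcases eq_or_ne i c with rfl | hic
    · rw [Function.update_self]
      refine ⟨hs.1.1, fun j hj => ?_, fun r hr hrs => ?_⟩
      · rw [hne hj le_rfl]
        exact hs.1.2 j hj
      · by_contra! hcon
        refine absurd (hs.2 ⟨hr, fun j hj => ?_⟩ hrs.le) (not_le.2 hrs)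
        rw [← hne hj le_rfl]
        exact hcon j hj
    · have hik : (i : ℕ) < k := by
        have : (i : ℕ) ≠ k := fun h => hic (Fin.ext h)
        omega
      rw [Function.update_of_ne hic]
      obtain ⟨h1, h2, h3⟩ := hσ i hik
      refine ⟨h1, fun j hj => ?_, fun r hr hrs => ?_⟩
      · rw [hne hj hik.le]
        exact h2 j hj
      · obtain ⟨j, hj, hjr⟩ := h3 r hr hrs
        exact ⟨j, hj, by rw [hne hj hik.le, hjr]⟩

theorem sum_drop_ofFn_ev (f : Fin n → Fin n) (t : ℕ) :
    ((List.ofFn (ev f)).drop t).sum = (Finset.univ.filter fun i => t ≤ (f i : ℕ)).card := by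
  have h1 : ((List.ofFn (ev f)).take t).sum + ((List.ofFn (ev f)).drop t).sum = n := by
    rw [← List.sum_append, List.take_append_drop, List.sum_ofFn, sum_ev]
  have h2 := Finset.card_filter_add_card_filter_not (s := (Finset.univ : Finset (Fin n)))
    (fun i => (f i : ℕ) < t)
  have h3 : ((List.ofFn (ev f)).take t).sum =
      (Finset.univ.filter fun i => (f i : ℕ) < t).card := by
    rw [List.sum_take_ofFn, Finset.card_eq_sum_card_fiberwise (f := f)
      (t := Finset.univ.filter fun j : Fin n => (j : ℕ) < t)]
    · refine Finset.sum_congr rfl fun j hj => ?_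
      rw [ev, Finset.filter_filter]
      congr 1
      ext i
      simp only [Finset.mem_filter, Finset.mem_univ, true_and] at hj ⊢
      exact ⟨by rintro rfl; exact ⟨hj, rfl⟩, fun h => h.2⟩
    · intro i hi
      simpa using hi
  simp only [not_lt, Finset.card_univ, Fintype.card_fin] at h2
  omega

theorem isParking_iff {f : Fin n → Fin n} :
    IsParking f ↔ List.ofFn (ev f) ∈ contents n 0 := by
  rw [mem_contents, isContent_iff]
  simp only [List.length_ofFn, sum_drop_ofFn_ev, List.sum_ofFn, sum_ev, zero_add, true_and]
  constructor
  · intro h t ht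
    have := h.isSparse t
    omega
  · intro h
    refine IsSparse.isParking fun t => ?_
    rcases le_or_gt t n with ht | ht
    · have := h t ht
      omega
    · rw [Finset.filter_false_of_mem]
      · simp
      · intro i _
        omega

theorem exists_ev_eq (e : Fin n → ℕ) {N : ℕ} (he : ∑ j, e j = N) :
    ∃ g : Fin N → Fin n, ev g = e := by
  let w := (∑ j, Multiset.replicate (e j) j).toList
  have hw : w.length = N := by
    simp [w, Multiset.card_sum, he]
  subst hw
  refine ⟨w.get, ?_⟩
  ext j
  rw [← count_ofFn, List.ofFn_get, ← Multiset.coe_count, Multiset.coe_toList, Multiset.count_sum']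
  simp [Multiset.count_replicate]

theorem ofFn_getD {l : List ℕ} (hl : l.length = n) :
    List.ofFn (fun j : Fin n => l.getD j 0) = l := by
  subst hl
  refine List.ext_getElem (by simp) fun i h1 h2 => ?_
  simp

/-- The evaluations of the `m`-multiparking functions. -/
def multiparkingEvs (m n : ℕ) : Finset (Fin n → ℕ) :=
  (contents n 0).image fun l j => m * l.getD j 0

theorem isMultiparking_iff {m : ℕ} {f : Fin (m * n) → Fin n} :
    IsMultiparking m n f ↔ ev f ∈ multiparkingEvs m n := by
  rw [IsMultiparking, multiparkingEvs, Finset.mem_image]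
  constructor
  · rintro ⟨g, hg, h⟩
    refine ⟨_, isParking_iff.1 hg, ?_⟩
    ext j
    simp [h]
  · rintro ⟨l, hl, h⟩
    obtain ⟨hlen, hl'⟩ := mem_contents.1 hl
    obtain ⟨g, hg⟩ := exists_ev_eq (fun j : Fin n => l.getD j 0) (N := n) (by
      have := (isContent_iff.1 hl').1
      rw [← List.sum_ofFn, ofFn_getD hlen]
      omega)
    refine ⟨g, isParking_iff.2 ?_, fun j => ?_⟩
    · rwa [hg, ofFn_getD hlen]
    · rw [← h, hg]

/-- The number of normal words with evaluation `m` times the given content. -/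
def contentWeight (m : ℕ) (l : List ℕ) : ℕ := insertionCount (l.map (m * ·))

/-- `N` is kept apart from `m * n` so that `m = 1` applies to functions on `Fin n` rather than `Fin
(1 * n)`. -/
theorem classCount_multiparkingEvs {m N : ℕ} (hm : 1 ≤ m) (hN : N = m * n) :
    classCount {f : Fin N → Fin n | ev f ∈ multiparkingEvs m n} =
      ∑ l ∈ contents n 0, contentWeight m l := by
  have hmap : ∀ l ∈ contents n 0,
      List.ofFn (fun j : Fin n => m * l.getD j 0) = l.map (m * ·) := by
    intro l hl
    conv_rhs => rw [← ofFn_getD (mem_contents.1 hl).1, List.map_ofFn]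
    rfl
  rw [classCount_eq_sum, multiparkingEvs, Finset.sum_image]
  · exact Finset.sum_congr rfl fun l hl => by rw [hmap l hl, contentWeight]
  · intro l hl l' hl' h
    have := congrArg List.ofFn h
    rw [hmap l hl, hmap l' hl'] at this
    exact List.map_injective_iff.2 (fun a b hab => Nat.eq_of_mul_eq_mul_left hm hab) this
  · intro e he
    obtain ⟨l, hl, rfl⟩ := Finset.mem_image.1 he
    obtain ⟨hlen, hl'⟩ := mem_contents.1 hl
    rw [← Finset.mul_sum, ← List.sum_ofFn, ofFn_getD hlen, hN]
    have := (isContent_iff.1 hl').1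
    rw [← hlen, ← this, zero_add]

theorem multiparkingCount_eq {m : ℕ} (hm : 1 ≤ m) (n : ℕ) :
    multiparkingCount m n = ∑ l ∈ contents n 0, contentWeight m l := by
  rw [← classCount_multiparkingEvs hm rfl, multiparkingCount]
  congr 1
  ext f
  exact isMultiparking_iff

theorem parkingCount_eq (n : ℕ) : parkingCount n = multiparkingCount 1 n := by
  rw [multiparkingCount_eq le_rfl, ← classCount_multiparkingEvs le_rfl (one_mul n).symm,
    parkingCount]
  congr 1
  ext f
  rw [Set.mem_ofPred_eq, Set.mem_ofPred_eq, isParking_iff, multiparkingEvs, Finset.mem_image]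
  constructor
  · intro h
    refine ⟨_, h, ?_⟩
    ext j
    simp
  · rintro ⟨l, hl, h⟩
    rw [← h]
    simp only [one_mul]
    rwa [ofFn_getD (mem_contents.1 hl).1]

end Parking

/-! ### Contents as Dyck paths. -/

section Dyck

theorem sum_Ico_getD_cons (x i : ℕ) (l : List ℕ) :
    ∑ j ∈ Finset.Ico (i + 1) (l.length + 1), (x :: l).getD j 0 =
      ∑ j ∈ Finset.Ico i l.length, l.getD j 0 := by
  rw [← Finset.sum_Ico_add']
  simp

theorem sum_Ico_getD (l : List ℕ) : ∑ j ∈ Finset.Ico 0 l.length, l.getD j 0 = l.sum := by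
  induction l with
  | nil => rfl
  | cons x l ih =>
    rw [List.length_cons, Finset.sum_eq_sum_Ico_succ_bot (Nat.succ_pos _), sum_Ico_getD_cons, ih]
    simp

theorem weight_cons (m x : ℕ) (l : List ℕ) : weight m (x :: l) = (1 + m * l.sum) * weight m l := by
  have h : weight m (x :: l) =
      ∏ i ∈ Finset.Ico 0 l.length, (1 + m * ∑ j ∈ Finset.Ico i l.length, l.getD j 0) := by
    rw [weight, List.length_cons]
    change ∏ i ∈ Finset.Ico (0 + 1) (l.length + 1), _ = _
    rw [← Finset.prod_Ico_add']
    simp only [sum_Ico_getD_cons]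
  rw [h]
  cases l with
  | nil => simp [weight]
  | cons y l =>
    rw [Finset.prod_eq_prod_Ico_succ_bot (by simp), sum_Ico_getD, weight]

/-- Zeros have factor 1 and do not affect suffix sums. A nonzero entry carries the suffix sum after
it, which is the factor indexed by the next block; the last block contributes 1. -/
theorem weight_filter {m : ℕ} (hm : 1 ≤ m) (l : List ℕ) :
    weight m (l.filter (0 < ·)) = contentWeight m l := by
  have hsum : ∀ l : List ℕ, (l.filter (0 < ·)).sum = l.sum := by
    intro l
    induction l with
    | nil => rfl
    | cons x l ih =>
      rw [List.filter_cons]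
      split_ifs with h
      · simp only [List.sum_cons, ih]
      · simp only [decide_eq_true_eq] at h
        rw [ih, List.sum_cons]
        omega
  induction l with
  | nil => rfl
  | cons x l ih =>
    rw [contentWeight, List.map_cons, insertionCount, ← contentWeight, ← ih, List.filter_cons,
      List.sum_map_mul_left, List.map_id']
    rcases Nat.eq_zero_or_pos x with rfl | hx
    · simp
    · have : m * x ≠ 0 := (Nat.mul_pos hm hx).ne'
      simp only [hx, decide_true, if_true, this, if_false]
      rw [weight_cons, hsum, add_comm]

open DyckStep

/-- The path with the given lengths of up-runs, each followed by one down-step. -/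
def pathOfContent (l : List ℕ) : List DyckStep := l.flatMap fun e => List.replicate e U ++ [D]

theorem pathOfContent_cons (e : ℕ) (l : List ℕ) :
    pathOfContent (e :: l) = List.replicate e U ++ D :: pathOfContent l := by
  simp [pathOfContent]

theorem count_U_pathOfContent (l : List ℕ) : (pathOfContent l).count U = l.sum := by
  induction l with
  | nil => rfl
  | cons e l ih => simp [pathOfContent_cons, ih]

theorem count_D_pathOfContent (l : List ℕ) : (pathOfContent l).count D = l.length := by
  induction l with
  | nil => rfl
  | cons e l ih => simp [pathOfContent_cons, ih, List.count_replicate]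

theorem splitOn_pathOfContent (l : List ℕ) :
    ((pathOfContent l).splitOn D).map List.length = l ++ [0] := by
  induction l with
  | nil => rfl
  | cons e l ih =>
    rw [pathOfContent_cons, List.splitOn_append_cons_self_of_not_mem (by simp [List.mem_replicate]),
      List.map_cons, ih]
    simp

/-- A path starting at height `h` does not go below height `0`. -/
def StaysNonneg (h : ℕ) (s : List DyckStep) : Prop :=
  ∀ i, (s.take i).count D ≤ h + (s.take i).count U

theorem staysNonneg_cons_U {h : ℕ} {s : List DyckStep} :
    StaysNonneg h (U :: s) ↔ StaysNonneg (h + 1) s := by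
  constructor
  · intro H i
    have := H (i + 1)
    simp only [List.take_succ_cons, List.count_cons_self, ne_eq, reduceCtorEq, not_false_eq_true,
      List.count_cons_of_ne] at this
    omega
  · intro H i
    cases i with
    | zero => simp
    | succ i =>
      have := H i
      simp only [List.take_succ_cons, List.count_cons_self, ne_eq, reduceCtorEq, not_false_eq_true,
        List.count_cons_of_ne]
      omega

theorem staysNonneg_cons_D {h : ℕ} {s : List DyckStep} :
    StaysNonneg h (D :: s) ↔ 1 ≤ h ∧ StaysNonneg (h - 1) s := by
  constructor
  · intro H
    have h1 : 1 ≤ h := by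
      have := H 1
      simpa using this
    refine ⟨h1, fun i => ?_⟩
    have := H (i + 1)
    simp only [List.take_succ_cons, List.count_cons_self, ne_eq, reduceCtorEq, not_false_eq_true,
      List.count_cons_of_ne] at this
    omega
  · rintro ⟨h1, H⟩ i
    cases i with
    | zero => simp
    | succ i =>
      have := H i
      simp only [List.take_succ_cons, List.count_cons_self, ne_eq, reduceCtorEq, not_false_eq_true,
        List.count_cons_of_ne]
      omega

theorem staysNonneg_replicate_append {h e : ℕ} {s : List DyckStep} :
    StaysNonneg h (List.replicate e U ++ s) ↔ StaysNonneg (h + e) s := by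
  induction e generalizing h with
  | zero => simp
  | succ e ih =>
    rw [List.replicate_succ, List.cons_append, staysNonneg_cons_U, ih, add_right_comm, add_assoc]

theorem isContent_iff_staysNonneg {h : ℕ} {l : List ℕ} :
    IsContent h l ↔ h + l.sum = l.length ∧ StaysNonneg h (pathOfContent l) := by
  induction l generalizing h with
  | nil => simp [IsContent, pathOfContent, StaysNonneg]
  | cons e l ih =>
    rw [IsContent, ih, pathOfContent_cons, staysNonneg_replicate_append, staysNonneg_cons_D,
      List.sum_cons, List.length_cons]
    constructor
    · rintro ⟨h1, h2, h3⟩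
      exact ⟨by omega, h1, h3⟩
    · rintro ⟨h1, h2, h3⟩
      exact ⟨h2, by omega, h3⟩

theorem exists_eq_pathOfContent (s : List DyckStep) :
    ∃ l k, s = pathOfContent l ++ List.replicate k U := by
  induction s with
  | nil => exact ⟨[], 0, rfl⟩
  | cons x s ih =>
    obtain ⟨l, k, rfl⟩ := ih
    cases x with
    | D => exact ⟨0 :: l, k, by simp [pathOfContent_cons]⟩
    | U =>
      cases l with
      | nil => exact ⟨[], k + 1, by simp [pathOfContent, List.replicate_succ]⟩
      | cons e l => exact ⟨(e + 1) :: l, k, by simp [pathOfContent_cons, List.replicate_succ]⟩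

/-- The Dyck word with the given content. -/
def dyckOfContent {l : List ℕ} (hl : IsContent 0 l) : DyckWord where
  toList := pathOfContent l
  count_U_eq_count_D := by
    rw [count_U_pathOfContent, count_D_pathOfContent, ← (isContent_iff.1 hl).1, zero_add]
  count_D_le_count_U i := by simpa using (isContent_iff_staysNonneg.1 hl).2 i

theorem blocks_dyckOfContent {l : List ℕ} (hl : IsContent 0 l) :
    blocks (dyckOfContent hl) = l.filter (0 < ·) := by
  rw [blocks, dyckOfContent, splitOn_pathOfContent]
  simp

theorem exists_dyckOfContent_eq (C : DyckWord) :
    ∃ l, ∃ hl : IsContent 0 l, dyckOfContent hl = C := by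
  obtain ⟨l, k, h⟩ := exists_eq_pathOfContent C.toList
  have h1 := C.count_U_eq_count_D
  -- The prefix before the trailing up-run already has at least as many up-steps as down-steps, so
  -- equality overall forces `k = 0`.
  have h2 := C.count_D_le_count_U (pathOfContent l).length
  rw [h, List.take_left' rfl, count_U_pathOfContent, count_D_pathOfContent] at h2
  rw [h, List.count_append, List.count_append, count_U_pathOfContent, count_D_pathOfContent,
    List.count_replicate_self, List.count_replicate, if_neg (by simp)] at h1
  obtain rfl : k = 0 := by omega
  rw [List.replicate_zero, List.append_nil] at h
  refine ⟨l, isContent_iff_staysNonneg.2 ⟨by omega, fun i => ?_⟩, DyckWord.ext h.symm⟩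
  rw [← h, zero_add]
  exact C.count_D_le_count_U i

theorem sum_contents_eq_sum_dyckWord {m : ℕ} (hm : 1 ≤ m) (n : ℕ) :
    ∑ l ∈ contents n 0, contentWeight m l =
      ∑ C : {C : DyckWord // C.semilength = n}, weight m (blocks C.1) := by
  refine Finset.sum_bij
    (fun l hl => ⟨dyckOfContent (mem_contents.1 hl).2, ?_⟩) ?_ ?_ ?_ ?_
  · rw [DyckWord.semilength_eq_count_D, dyckOfContent, count_D_pathOfContent, (mem_contents.1 hl).1]
  · exact fun _ _ => Finset.mem_univ _
  · intro l hl l' hl' h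
    have h1 := congrArg DyckWord.toList (congrArg Subtype.val h)
    have h2 := congrArg (fun s => (List.splitOn D s).map List.length) h1
    simp only [dyckOfContent, splitOn_pathOfContent] at h2
    exact List.append_cancel_right h2
  · rintro ⟨C, hC⟩ -
    obtain ⟨l, hl, rfl⟩ := exists_dyckOfContent_eq C
    rw [DyckWord.semilength_eq_count_D, dyckOfContent, count_D_pathOfContent] at hC
    exact ⟨l, mem_contents.2 ⟨hC, hl⟩, rfl⟩
  · intro l hl
    rw [blocks_dyckOfContent, weight_filter hm]

end Dyck

/-! ### Recursion on height and remaining up-steps. -/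

section Recursion

/-- The total weight of the contents at height `h` with `r` up-steps left. -/
def contentSum (m h r : ℕ) : ℕ := ∑ l ∈ contents (h + r) h, contentWeight m l

/-- The total weight of the contents at height `h` with `r` up-steps left, when one more block has
been read before. -/
def blockSum (m h r : ℕ) : ℕ := (1 + m * r) * contentSum m h r

/-- The total weight of the contents at height `h` with `r` up-steps left that do not start with a
down-step. -/
def upSum (m h r : ℕ) : ℕ := ∑ e ∈ Finset.range r, blockSum m (h + e) (r - 1 - e)

theorem contentWeight_cons {m : ℕ} (e : ℕ) (l : List ℕ) :
    contentWeight m (e :: l) = (if m * e = 0 then 1 else 1 + m * l.sum) * contentWeight m l := by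
  rw [contentWeight, List.map_cons, insertionCount, List.sum_map_mul_left, List.map_id',
    add_comm (m * _), contentWeight]

/-- Split by the first entry: zero is a down-step to `h - 1`; a block of `e + 1` up-steps and its
down-step lead to height `h + e` with `r - 1 - e` up-steps left, the factor of the block being
absorbed in `blockSum`. -/
theorem contentSum_eq {m : ℕ} (hm : 1 ≤ m) {h r : ℕ} (hr : 1 ≤ h + r) :
    contentSum m h r = upSum m h r + if 1 ≤ h then contentSum m (h - 1) r else 0 := by
  obtain ⟨N, hN⟩ := Nat.exists_eq_add_of_le' hr
  have key : contentSum m h r = ∑ e ∈ Finset.range (r + 1), if 1 ≤ h + e then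
      ∑ l ∈ contents N (h + e - 1), contentWeight m (e :: l) else 0 := by
    rw [contentSum, hN, contents, Finset.sum_biUnion, Finset.sum_filter]
    · have : N + 2 - h = r + 1 := by omega
      rw [this]
      refine Finset.sum_congr rfl fun e _ => ?_
      congr 1
      rw [Finset.sum_image]
      exact fun _ _ _ _ hl => (List.cons.inj hl).2
    · intro e _ e' _ hne
      refine Finset.disjoint_left.2 fun l hl hl' => hne ?_
      obtain ⟨_, -, rfl⟩ := Finset.mem_image.1 hl
      obtain ⟨_, -, h'⟩ := Finset.mem_image.1 hl'
      exact (List.cons.inj h').1.symm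
  rw [key, Finset.sum_range_succ']
  congr 1
  · refine Finset.sum_congr rfl fun e he => ?_
    rw [Finset.mem_range] at he
    have h1 : N = h + e + (r - 1 - e) := by omega
    rw [if_pos (by omega), blockSum, contentSum, Finset.mul_sum, ← h1]
    refine Finset.sum_congr rfl fun l hl => ?_
    obtain ⟨hl1, hl2⟩ := mem_contents.1 hl
    have := (isContent_iff.1 hl2).1
    have hs : l.sum = r - 1 - e := by omega
    rw [contentWeight_cons, if_neg, hs]
    exact (Nat.mul_pos hm (Nat.succ_pos e)).ne'
  · rw [add_zero]
    split_ifs with h1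
    · have h1 : N = h - 1 + r := by omega
      rw [contentSum, ← h1]
      exact Finset.sum_congr rfl fun l _ => by rw [contentWeight_cons]; simp
    · rfl

theorem blockSum_zero_zero (m : ℕ) : blockSum m 0 0 = 1 := by
  simp [blockSum, contentSum, contents, contentWeight, insertionCount]

theorem blockSum_zero {m : ℕ} (hm : 1 ≤ m) {r : ℕ} (hr : 1 ≤ r) :
    blockSum m 0 r = (1 + m * r) * upSum m 0 r := by
  rw [blockSum, contentSum_eq hm (by omega)]
  simp

theorem blockSum_succ {m : ℕ} (hm : 1 ≤ m) (h r : ℕ) :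
    blockSum m (h + 1) r = blockSum m h r + (1 + m * r) * upSum m (h + 1) r := by
  rw [blockSum, contentSum_eq hm (by omega), if_pos (by omega), Nat.add_sub_cancel, blockSum]
  ring

theorem blockSum_zero_right {m : ℕ} (hm : 1 ≤ m) (h : ℕ) : blockSum m h 0 = 1 := by
  induction h with
  | zero => exact blockSum_zero_zero m
  | succ h ih => rw [blockSum_succ hm, ih]; simp [upSum]

/-- The path first descends from `h` to the height `d` at which its next block starts. -/
theorem blockSum_eq_sum_upSum {m : ℕ} (hm : 1 ≤ m) (h : ℕ) {r : ℕ} (hr : 1 ≤ r) :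
    blockSum m h r = (1 + m * r) * ∑ d ∈ Finset.range (h + 1), upSum m d r := by
  induction h with
  | zero => rw [blockSum_zero hm hr]; simp
  | succ h ih => rw [blockSum_succ hm, ih, Finset.sum_range_succ _ (h + 1), mul_add]

/-- After one up-step, the block either ends or continues from height `h + 1`. -/
theorem upSum_succ (m h r : ℕ) : upSum m h (r + 1) = blockSum m h r + upSum m (h + 1) r := by
  rw [upSum, Finset.sum_range_succ', add_comm, upSum]
  congr 1
  refine Finset.sum_congr rfl fun e _ => ?_
  congr 1 <;> omega

theorem multiparkingCount_eq_upSum {m : ℕ} (hm : 1 ≤ m) {n : ℕ} (hn : 1 ≤ n) :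
    multiparkingCount m n = upSum m 0 n := by
  have : multiparkingCount m n = contentSum m 0 n := by
    rw [multiparkingCount_eq hm, contentSum, zero_add]
  rw [this, contentSum_eq hm (by omega)]
  simp

theorem multiparkingCount_recursion {m : ℕ} (hm : 1 ≤ m) :
    ∃ p : ℕ → ℕ → ℕ,
      (∀ n, 1 ≤ n → p n n = 1) ∧
      (∀ n k, 1 ≤ k → k < n →
        p n k = (1 + m * (n - k)) *
          ∑ i ∈ Finset.Icc (n - k) (n - 1), ∑ j ∈ Finset.Icc (k + 1 + i - n) i, p i j) ∧
      ∀ n, 1 ≤ n → multiparkingCount m n = ∑ k ∈ Finset.Icc 1 n, p n k := by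
  -- The index `k` is the length of the first block: its down-step leads to height `k - 1`, with `n
  -- - k` up-steps left.
  refine ⟨fun n k => blockSum m (k - 1) (n - k), fun n _ => ?_, fun n k hk hkn => ?_,
    fun n hn => ?_⟩
  · simp only [Nat.sub_self]
    exact blockSum_zero_right hm _
  · obtain ⟨r, rfl⟩ := Nat.exists_eq_add_of_lt hkn
    obtain ⟨h, rfl⟩ := Nat.exists_eq_add_of_le' hk
    have e1 : h + 1 + r + 1 - (h + 1) = r + 1 := by omega
    have e2 : Finset.Icc (r + 1) (h + 1 + r) =
        Finset.Ico (0 + (r + 1)) (h + 1 + (r + 1)) := by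
      ext i
      simp only [Finset.mem_Icc, Finset.mem_Ico]
      omega
    simp only [e1, Nat.add_sub_cancel]
    rw [blockSum_eq_sum_upSum hm _ (by omega), e2, ← Finset.sum_Ico_add', Finset.range_eq_Ico]
    congr 1
    refine Finset.sum_congr rfl fun d _ => ?_
    -- With `i = d + (n - k)`, the substitution `j = d + 1 + e` makes `j` the peak height of a block
    -- of `e + 1` up-steps starting at height `d`.
    have e3 : Finset.Icc (h + 1 + 1 + (d + (r + 1)) - (h + 1 + r + 1)) (d + (r + 1)) =
        Finset.Ico (0 + (d + 1)) (r + 1 + (d + 1)) := by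
      ext i
      simp only [Finset.mem_Icc, Finset.mem_Ico]
      omega
    rw [e3, ← Finset.sum_Ico_add', upSum, Finset.range_eq_Ico]
    refine Finset.sum_congr rfl fun e _ => ?_
    congr 1 <;> omega
  · have e : Finset.Icc 1 n = Finset.Ico (0 + 1) (n + 1) := by
      ext i
      simp only [Finset.mem_Icc, Finset.mem_Ico]
      omega
    rw [multiparkingCount_eq_upSum hm hn, e, ← Finset.sum_Ico_add', upSum, Finset.range_eq_Ico]
    refine Finset.sum_congr rfl fun e _ => ?_
    congr 1 <;> omega

end Recursion

/-! ### The generating function identity. -/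

section Series

open PowerSeries

/-- The series `x ^ n (1 - x) ^ n / ∏ (1 + m l x)`, with the product over `1 ≤ l ≤ n`. -/
noncomputable def kernel (m n : ℕ) : ℚ⟦X⟧ :=
  X ^ n * (1 - X) ^ n * (∏ l ∈ Finset.Icc 1 n, (1 + C ((m : ℚ) * (l : ℚ)) * X))⁻¹

theorem kernel_succ (m n : ℕ) :
    kernel m (n + 1) * (1 + C ((m : ℚ) * ((n + 1 : ℕ) : ℚ)) * X) = kernel m n * (X * (1 - X)) := by
  have h : constantCoeff (1 + C ((m : ℚ) * ((n + 1 : ℕ) : ℚ)) * X : ℚ⟦X⟧) ≠ 0 := by simp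
  rw [kernel, Finset.prod_Icc_succ_top (by omega), PowerSeries.mul_inv_rev, kernel]
  have := PowerSeries.inv_mul_cancel _ h
  linear_combination (X ^ (n + 1) * (1 - X) ^ (n + 1) *
    (∏ l ∈ Finset.Icc 1 n, (1 + C ((m : ℚ) * (l : ℚ)) * X))⁻¹ : ℚ⟦X⟧) * this

/-- The generating function of `blockSum m · r`. -/
noncomputable def blockSeries (m r : ℕ) : ℚ⟦X⟧ := mk fun h => (blockSum m h r : ℚ)

/-- The generating function of `upSum m · r`. -/
noncomputable def upSeries (m r : ℕ) : ℚ⟦X⟧ := mk fun h => (upSum m h r : ℚ)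

theorem one_sub_X_mul_blockSeries_zero {m : ℕ} (hm : 1 ≤ m) : (1 - X) * blockSeries m 0 = 1 := by
  ext h
  rw [sub_mul, one_mul, map_sub]
  cases h with
  | zero => simp [blockSeries, blockSum_zero_right hm]
  | succ h => simp [blockSeries, blockSum_zero_right hm, coeff_succ_X_mul, coeff_one]

theorem one_sub_X_mul_blockSeries {m : ℕ} (hm : 1 ≤ m) {r : ℕ} (hr : 1 ≤ r) :
    (1 - X) * blockSeries m r = C (1 + (m : ℚ) * (r : ℚ)) * upSeries m r := by
  ext h
  rw [sub_mul, one_mul, map_sub, coeff_C_mul]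
  cases h with
  | zero => simp [blockSeries, upSeries, blockSum_zero hm hr]
  | succ h =>
    simp [blockSeries, upSeries, blockSum_succ hm, coeff_succ_X_mul]

theorem X_mul_upSeries_succ (m r : ℕ) :
    X * upSeries m (r + 1) = X * blockSeries m r + upSeries m r - C (upSum m 0 r : ℚ) := by
  ext h
  rw [map_sub, map_add, coeff_C]
  cases h with
  | zero => simp [upSeries]
  | succ h =>
    simp [blockSeries, upSeries, upSum_succ, coeff_succ_X_mul]

/-- Write G_r for `upSeries m r`. Eliminating `blockSeries` gives X(1-X)G_{r+1} = (1+mrX)G_r -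
(1-X)G_r(0) for r ≥ 1. Multiplied by `kernel m r`, which turns 1+mrX into X(1-X) times the previous
kernel, this telescopes; the initial value is X(1-X)G_1 = X. -/
theorem one_sub_X_mul_sum {m : ℕ} (hm : 1 ≤ m) (N : ℕ) :
    (1 - X) * ∑ n ∈ Finset.range N, C (upSum m 0 (n + 1) : ℚ) * kernel m (n + 1) =
      X - kernel m N * (X * (1 - X)) * upSeries m (N + 1) := by
  induction N with
  | zero =>
    have h1 := X_mul_upSeries_succ m 0
    have h2 : upSeries m 0 = 0 := by ext; simp [upSeries, upSum]
    have h3 : kernel m 0 = 1 := by simp [kernel]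
    have h4 := one_sub_X_mul_blockSeries_zero hm
    rw [h2] at h1
    simp only [upSum, Finset.range_zero, Finset.sum_empty, Nat.cast_zero, map_zero] at h1
    rw [Finset.range_zero, Finset.sum_empty, h3]
    linear_combination (1 - X) * h1 + X * h4
  | succ N ih =>
    rw [Finset.sum_range_succ, mul_add, ih, ← kernel_succ]
    have h1 := X_mul_upSeries_succ m (N + 1)
    have h2 := one_sub_X_mul_blockSeries hm (r := N + 1) (by omega)
    have h3 : (C (1 + (m : ℚ) * ((N + 1 : ℕ) : ℚ)) : ℚ⟦X⟧) =
        1 + C ((m : ℚ) * ((N + 1 : ℕ) : ℚ)) := by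
      rw [map_add, map_one]
    rw [h3] at h2
    linear_combination kernel m (N + 1) * (1 - X) * h1 + kernel m (N + 1) * X * h2

theorem hasSum_kernel {m : ℕ} (hm : 1 ≤ m) :
    HasSum (fun n : ℕ => C (multiparkingCount m (n + 1) : ℚ) * kernel m (n + 1))
      ((X : ℚ⟦X⟧) * (1 - X)⁻¹) := by
  have hdvd : ∀ n, (X : ℚ⟦X⟧) ^ n ∣ kernel m n := fun n => by
    rw [kernel, mul_assoc]
    exact dvd_mul_right _ _
  rw [PowerSeries.WithPiTopology.hasSum_iff_hasSum_coeff]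
  intro d
  have hinv : (1 - X : ℚ⟦X⟧)⁻¹ * (1 - X) = 1 := PowerSeries.inv_mul_cancel _ (by simp)
  have hsum : coeff d ((X : ℚ⟦X⟧) * (1 - X)⁻¹) = ∑ n ∈ Finset.range d,
      coeff d (C (multiparkingCount m (n + 1) : ℚ) * kernel m (n + 1)) := by
    simp only [multiparkingCount_eq_upSum hm (Nat.succ_pos _)]
    rw [← map_sum, ← sub_eq_zero, ← map_sub]
    -- The remainder after `d` terms is divisible by `X ^ (d + 1)`, so it does not reach coefficient
    -- `d`.
    refine X_pow_dvd_iff.1 ?_ d (Nat.lt_succ_self d)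
    have e : (X : ℚ⟦X⟧) * (1 - X)⁻¹ -
        ∑ n ∈ Finset.range d, C (upSum m 0 (n + 1) : ℚ) * kernel m (n + 1) =
        kernel m d * X * upSeries m (d + 1) := by
      linear_combination (-(1 - X : ℚ⟦X⟧)⁻¹) * one_sub_X_mul_sum hm d +
        (∑ n ∈ Finset.range d, C (upSum m 0 (n + 1) : ℚ) * kernel m (n + 1) +
          kernel m d * X * upSeries m (d + 1)) * hinv
    rw [e, pow_succ]
    exact (mul_dvd_mul_right (hdvd d) X).mul_right _
  rw [hsum]
  refine hasSum_sum_of_ne_finset_zero fun n hn => ?_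
  rw [Finset.mem_range, not_lt] at hn
  exact X_pow_dvd_iff.1 ((hdvd (n + 1)).mul_left _) d (by omega)

end Series

end Metasylvester

theorem mainTheorem10 :
    (∀ m : ℕ, 1 ≤ m →
      (∀ n : ℕ, Metasylvester.multiparkingCount m n =
        ∑ C : {C : DyckWord // C.semilength = n},
          Metasylvester.weight m (Metasylvester.blocks C.1)) ∧
      (∃ p : ℕ → ℕ → ℕ,
        (∀ n, 1 ≤ n → p n n = 1) ∧
        (∀ n k, 1 ≤ k → k < n →
          p n k = (1 + m * (n - k)) *
            ∑ i ∈ Finset.Icc (n - k) (n - 1), ∑ j ∈ Finset.Icc (k + 1 + i - n) i, p i j) ∧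
        ∀ n, 1 ≤ n → Metasylvester.multiparkingCount m n = ∑ k ∈ Finset.Icc 1 n, p n k) ∧
      HasSum
        (fun n : ℕ =>
          PowerSeries.C (Metasylvester.multiparkingCount m (n + 1) : ℚ) *
            (PowerSeries.X ^ (n + 1) * (1 - PowerSeries.X) ^ (n + 1) *
              (∏ l ∈ Finset.Icc 1 (n + 1),
                (1 + PowerSeries.C ((m : ℚ) * (l : ℚ)) * PowerSeries.X))⁻¹))
        ((PowerSeries.X : ℚ⟦X⟧) * (1 - PowerSeries.X)⁻¹)) ∧
    (∀ n : ℕ, Metasylvester.parkingCount n = Metasylvester.multiparkingCount 1 n) ∧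
    HasSum
      (fun n : ℕ =>
        PowerSeries.C (Metasylvester.parkingCount (n + 1) : ℚ) *
          (PowerSeries.X ^ (n + 1) * (1 - PowerSeries.X) ^ (n + 1) *
            (∏ l ∈ Finset.Icc 1 (n + 1),
              (1 + PowerSeries.C (l : ℚ) * PowerSeries.X))⁻¹))
      ((PowerSeries.X : ℚ⟦X⟧) * (1 - PowerSeries.X)⁻¹) := by
  open Metasylvester in
  refine ⟨fun m hm => ⟨fun n => ?_, multiparkingCount_recursion hm, hasSum_kernel hm⟩,
    parkingCount_eq, ?_⟩
  · rw [multiparkingCount_eq hm, sum_contents_eq_sum_dyckWord hm]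
  · have h := hasSum_kernel le_rfl
    simpa only [kernel, parkingCount_eq, Nat.cast_one, one_mul] using h
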